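/- Let $0<v<1$ and $L>0$, put $\mathbf I_t=(vt,L+vt)$, and let $J=[0,\infty)$ or $J=[0,T]$ with $T>0$. Let $\phi^0\in H^1_0(0,L)$ and $\phi^1\in L^2(0,L)$ be real-valued, and let $\phi$ be a weak solution of $$\phi_{tt}-\phi_{xx}=0 \ \ (x\in\mathbf I_t,\ t\in J),\qquad \phi(vt,t)=\phi(L+vt,t)=0\ \ (t\in J),\qquad \phi(\cdot,0)=\phi^0,\quad \phi_t(\cdot,0)=\phi^1 \ \text{ on } (0,L),$$ with $\phi\in C(J;H^1_0(\mathbf I_t))$ and $\phi_t\in C(J;L^2(\mathbf I_t))$. Here the wave equation holds in the sense of distributions on $\{(x,t): t\in \operatorname{int}J,\ x\in\mathbf I_t\}$, the derivatives $\phi_x,\phi_t$ are weak derivatives, the boundary conditions are those contained in $H^1_0(\mathbf I_t)$, and continuity in time with values in spaces over the moving interval is understood after the translation $x=y+vt$, $y\in(0,L)$. Define $$\mathcal E_v(t)=\frac12\int_{vt}^{L+vt}\big((\phi_t+v\phi_x)^2+(1-v^2)\phi_x^2\big)\,dx,\qquad E_v(t)=\frac12\int_{vt}^{L+vt}\big(\phi_t^2+\phi_x^2\big)\,dx,\qquad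 \gamma_v=\frac{1+v}{1-v}.$$ Then, for every $t\in J$, $$\frac{\mathcal E_v(t)}{1+v}\le E_v(t)\le\frac{\mathcal E_v(t)}{1-v} \qquad\text{and}\qquad \frac1{\gamma_v}E_v(0)\le E_v(t)\le\gamma_v E_v(0).$$ -/

import Mathlib

open Set Filter Topology MeasureTheory
open scoped ContDiff

namespace MovingString

noncomputable section

/-- Test functions `C_c^∞(U)` on an open subset `U` of a normed space. -/
structure IsTestFunction {X : Type*} [NormedAddCommGroup X] [NormedSpace ℝ X]
    (U : Set X) (ψ : X → ℝ) : Prop where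
  contDiff : ContDiff ℝ ∞ ψ
  hasCompactSupport : HasCompactSupport ψ
  tsupport_subset : tsupport ψ ⊆ U

/-- `f ∈ L²(a, b)`. -/
def MemL2 (a b : ℝ) (f : ℝ → ℝ) : Prop :=
  MemLp f 2 (volume.restrict (Ioo a b))

/-- The norm of `L²(a, b)`. -/
def normL2 (a b : ℝ) (f : ℝ → ℝ) : ENNReal :=
  eLpNorm f 2 (volume.restrict (Ioo a b))

/-- `u ∈ H¹(a, b)` with weak derivative `u' = p ∈ L²(a, b)`. -/
structure HasH1Deriv (a b : ℝ) (u p : ℝ → ℝ) : Prop where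
  memL2 : MemL2 a b u
  memL2_deriv : MemL2 a b p
  weak_deriv : ∀ ψ : ℝ → ℝ, IsTestFunction (Ioo a b) ψ →
    ∫ x in Ioo a b, u x * deriv ψ x = -∫ x in Ioo a b, p x * ψ x

/-- `u ∈ H¹₀(a, b)` with weak derivative `u' = p`: the function `u` is in `H¹(a, b)` and it is
the limit, in the norm of `H¹(a, b)`, of a sequence in `C_c^∞(a, b)`. -/
structure HasH10Deriv (a b : ℝ) (u p : ℝ → ℝ) : Prop extends HasH1Deriv a b u p where
  approx : ∃ ψ : ℕ → ℝ → ℝ, (∀ n, IsTestFunction (Ioo a b) (ψ n)) ∧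
    Tendsto (fun n => normL2 a b (fun x => u x - ψ n x)) atTop (𝓝 0) ∧
    Tendsto (fun n => normL2 a b (fun x => p x - deriv (ψ n) x)) atTop (𝓝 0)

/-- `u ∈ H¹₀(a, b)`. -/
def MemH10 (a b : ℝ) (u : ℝ → ℝ) : Prop := ∃ p, HasH10Deriv a b u p

/-- The interval `I_t = (v t, L + v t)` occupied by the string at time `t`. -/
def interval (v L t : ℝ) : Set ℝ := Ioo (v * t) (L + v * t)

/-- The open space-time domain swept by the string at times in the interior of `J`;
points are written `(x, t)`. -/
def domain (v L : ℝ) (J : Set ℝ) : Set (ℝ × ℝ) :=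
  {z | z.2 ∈ interior J ∧ z.1 ∈ interval v L z.2}

/-- `f ∈ C(J; L²(I_t))`, where `f x t` is the value at the point `x` and the time `t`. Functions
on the moving intervals are compared after the translation `x = y + v t`, `y ∈ (0, L)`. -/
def ContinuousL2 (v L : ℝ) (J : Set ℝ) (f : ℝ → ℝ → ℝ) : Prop :=
  (∀ t ∈ J, MemL2 (v * t) (L + v * t) (fun x => f x t)) ∧
  ∀ s ∈ J, Tendsto (fun t => normL2 0 L (fun y => f (y + v * t) t - f (y + v * s) s))
    (𝓝[J] s) (𝓝 0)

/-- `φ`, with weak derivatives `φx` and `φt` in space and time, is a weak solution on the time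
interval `J`, starting at `0`, of the problem
`φ_tt - φ_xx = 0` in `I_t`, `φ(vt, t) = φ(L + vt, t) = 0`, `φ(·, 0) = φ0`, `φ_t(·, 0) = φ1`,
in the class `φ ∈ C(J; H¹₀(I_t))`, `φ_t ∈ C(J; L²(I_t))`.
The inner space integrals below depend only on the classes of the functions at each time modulo
equality almost everywhere, and they are continuous functions of the time. -/
structure IsSolution (v L : ℝ) (J : Set ℝ) (φ0 φ1 : ℝ → ℝ) (φ φx φt : ℝ → ℝ → ℝ) : Prop where
  /-- The boundary conditions and the weak derivative in space. -/
  memH10 : ∀ t ∈ J,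
    HasH10Deriv (v * t) (L + v * t) (fun x => φ x t) (fun x => φx x t)
  continuous : ContinuousL2 v L J φ
  continuous_x : ContinuousL2 v L J φx
  continuous_t : ContinuousL2 v L J φt
  /-- `φt` is the weak time derivative of `φ`. -/
  weak_time_deriv : ∀ ψ : ℝ × ℝ → ℝ, IsTestFunction (domain v L J) ψ →
    ∫ t in J, ∫ x in interval v L t, φ x t * deriv (fun s => ψ (x, s)) t =
      -∫ t in J, ∫ x in interval v L t, φt x t * ψ (x, t)
  /-- The wave equation in the sense of distributions. -/
  wave : ∀ ψ : ℝ × ℝ → ℝ, IsTestFunction (domain v L J) ψ →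
    ∫ t in J, ∫ x in interval v L t,
      (φt x t * deriv (fun s => ψ (x, s)) t - φx x t * deriv (fun y => ψ (y, t)) x) = 0
  initial : ∀ᵐ x ∂(volume.restrict (Ioo 0 L)), φ x 0 = φ0 x
  initial_t : ∀ᵐ x ∂(volume.restrict (Ioo 0 L)), φt x 0 = φ1 x

/-- The energy `𝓔_v(t) = ½ ∫_{I_t} (φ_t + v φ_x)² + (1 - v²) φ_x² dx`. -/
def energy (v L : ℝ) (φx φt : ℝ → ℝ → ℝ) (t : ℝ) : ℝ :=
  1 / 2 * ∫ x in interval v L t,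
    ((φt x t + v * φx x t) ^ 2 + (1 - v ^ 2) * φx x t ^ 2)

/-- The usual energy `E_v(t) = ½ ∫_{I_t} φ_t² + φ_x² dx`. -/
def usualEnergy (v L : ℝ) (φx φt : ℝ → ℝ → ℝ) (t : ℝ) : ℝ :=
  1 / 2 * ∫ x in interval v L t, (φt x t ^ 2 + φx x t ^ 2)

/-- The constant `γ_v = (1 + v) / (1 - v)`. -/
def gam (v : ℝ) : ℝ := (1 + v) / (1 - v)

end

end MovingString

/-! In the frame `y = x - v t` the problem becomes a system for continuous curves in `L²(0, L)`:
with `u`, `q`, `f` the translates of `φ`, `φx`, `φt`, one has `u' = f + v q` and, weakly, `f' = (v f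
+ q)_y`. Formally, testing the second equation with `u'`, which vanishes at the ends, shows that `‖f
+ v q‖² + (1 - v²) ‖q‖²` is constant. A weak solution is not regular enough for this, so
`energy_conserved` works with integrals over windows `[t, t + h]`. The window integral `P` of `u'`
is an increment of `u`, hence an admissible test function, and it is differentiable in time. The
energy of the window integrals is exactly constant; dividing by `h²` and letting `h → 0` gives
conservation. The distributional equations reach the integrated form by testing with `a (x - v t) b
t` and applying du Bois-Reymond in time (`sub_eq_integral_of_weak_deriv`). The bounds then follow
from the pointwise comparison of the two energy densities. -/

namespace MovingString

noncomputable section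

/-! ### Energy conservation in a Hilbert space. -/

section Abstract

variable {H : Type*} [NormedAddCommGroup H] [InnerProductSpace ℝ H] [CompleteSpace H]

/-- The primitive over a window of fixed length of a continuous curve is differentiable. -/
theorem hasDerivAt_integral_window {g : ℝ → H} (hg : Continuous g) (h t : ℝ) :
    HasDerivAt (fun t => ∫ s in t..t + h, g s) (g (t + h) - g t) t := by
  have key : ∀ x, HasDerivAt (fun t => ∫ s in (0 : ℝ)..t, g s) (g x) x := fun x =>
    intervalIntegral.integral_hasDerivAt_right (hg.intervalIntegrable _ _)
      (hg.stronglyMeasurableAtFilter _ _) hg.continuousAt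
  have := ((key (t + h)).comp_add_const t h).sub (key t)
  refine this.congr_of_eventuallyEq (Eventually.of_forall fun x => ?_)
  exact (intervalIntegral.integral_interval_sub_left (hg.intervalIntegrable _ _)
    (hg.intervalIntegrable _ _)).symm

theorem tendsto_average_right {g : ℝ → H} (hg : Continuous g) (t : ℝ) :
    Tendsto (fun h : ℝ => h⁻¹ • ∫ s in t..t + h, g s) (𝓝[>] 0) (𝓝 (g t)) := by
  have key : HasDerivAt (fun x => ∫ s in t..x, g s) (g t) t :=
    intervalIntegral.integral_hasDerivAt_right (hg.intervalIntegrable _ _)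
      (hg.stronglyMeasurableAtFilter _ _) hg.continuousAt
  have h2 := key.tendsto_slope_zero
  simp only [intervalIntegral.integral_same, sub_zero] at h2
  exact h2.mono_left (nhdsWithin_mono _ fun x hx => ne_of_gt hx)

/-- Needed at the final time `T`, where the window must stay inside `[0, T]`; the upper limit keeps
the form `start + h` of the windows in `energy_conserved`. -/
theorem tendsto_average_left {g : ℝ → H} (hg : Continuous g) (t : ℝ) :
    Tendsto (fun h : ℝ => h⁻¹ • ∫ s in (t - h)..(t - h) + h, g s) (𝓝[>] 0) (𝓝 (g t)) := by
  have key : HasDerivAt (fun x => ∫ s in t..x, g s) (g t) t :=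
    intervalIntegral.integral_hasDerivAt_right (hg.intervalIntegrable _ _)
      (hg.stronglyMeasurableAtFilter _ _) hg.continuousAt
  have h2 := key.tendsto_slope_zero
  simp only [intervalIntegral.integral_same, sub_zero] at h2
  have hneg : Tendsto (fun h : ℝ => -h) (𝓝[>] 0) (𝓝[≠] 0) := by
    refine tendsto_nhdsWithin_iff.2 ⟨?_, ?_⟩
    · have : Tendsto (fun h : ℝ => -h) (𝓝 0) (𝓝 (-0)) := tendsto_id.neg
      rw [neg_zero] at this
      exact this.mono_left nhdsWithin_le_nhds
    · filter_upwards [self_mem_nhdsWithin] with h hh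
      simpa using (ne_of_gt hh)
  refine (h2.comp hneg).congr fun h => ?_
  simp only [Function.comp_apply, sub_add_cancel]
  rw [intervalIntegral.integral_symm, inv_neg, ← sub_eq_add_neg]
  simp

/-- Conservation of the energy for an abstract second order equation: `q` plays the role of the
space derivative of `u`, `f + v q` is the time derivative of `u`, and the time derivative of `f`
is the weak space derivative of `v f + q`. -/
theorem energy_conserved {v T : ℝ} (hT : 0 < T) {u q f : ℝ → H} (hq : Continuous q)
    (hf : Continuous f) (S : Submodule ℝ (H × H))
    (hS : ∀ t ∈ Icc 0 T, (u t, q t) ∈ S.topologicalClosure)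
    (hu : ∀ s ∈ Icc 0 T, ∀ t ∈ Icc 0 T, u t - u s = ∫ τ in s..t, (f τ + v • q τ))
    (hw : ∀ z ∈ S, ∀ s ∈ Icc 0 T, ∀ t ∈ Icc 0 T,
      inner ℝ (f t - f s) z.1 = -∫ τ in s..t, inner ℝ (v • f τ + q τ) z.2) :
    ‖f T + v • q T‖ ^ 2 + (1 - v ^ 2) * ‖q T‖ ^ 2 =
      ‖f 0 + v • q 0‖ ^ 2 + (1 - v ^ 2) * ‖q 0‖ ^ 2 := by
  have hp : Continuous fun t => f t + v • q t := hf.add (hq.const_smul v)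
  have hr : Continuous fun t => v • f t + q t := (hf.const_smul v).add hq
  -- the weak equation for all pairs in the closure
  have hw' : ∀ z ∈ S.topologicalClosure, ∀ s ∈ Icc 0 T, ∀ t ∈ Icc 0 T,
      inner ℝ (f t - f s) z.1 = -inner ℝ (∫ τ in s..t, (v • f τ + q τ)) z.2 := by
    intro z hz s hs t ht
    -- With the time integral inside the inner product, both sides are visibly continuous in `z`.
    have hcl : IsClosed {z : H × H | inner ℝ (f t - f s) z.1 =
        -inner ℝ (∫ τ in s..t, (v • f τ + q τ)) z.2} := by
      refine isClosed_eq ?_ ?_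
      · exact continuous_const.inner continuous_fst
      · exact (continuous_const.inner continuous_snd).neg
    refine closure_minimal (fun z hz => ?_) hcl hz
    rw [mem_ofPred_eq, hw z hz s hs t ht, real_inner_comm]
    congr 1
    have := ((innerSL ℝ z.2).intervalIntegral_comp_comm (hr.intervalIntegrable (μ := volume) s t))
    simp only [innerSL_apply_apply] at this
    rw [← this]
    exact intervalIntegral.integral_congr fun τ _ => real_inner_comm _ _
  set P : ℝ → ℝ → H := fun h t => ∫ s in t..t + h, (f s + v • q s) with hP
  set Q : ℝ → ℝ → H := fun h t => ∫ s in t..t + h, q s with hQ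
  -- Integrates `v f + q = v (f + v q) + (1 - v²) q`.
  have hR : ∀ h t, ∫ s in t..t + h, (v • f s + q s) = v • P h t + (1 - v ^ 2) • Q h t := by
    intro h t
    simp only [hP, hQ]
    rw [← intervalIntegral.integral_smul, ← intervalIntegral.integral_smul,
      ← intervalIntegral.integral_add
        (Continuous.intervalIntegrable (by fun_prop) _ _)
        (Continuous.intervalIntegrable (by fun_prop) _ _)]
    refine intervalIntegral.integral_congr fun τ _ => ?_
    module
  have hconst : ∀ h ∈ Ioo 0 T, ‖P h (T - h)‖ ^ 2 + (1 - v ^ 2) * ‖Q h (T - h)‖ ^ 2 =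
      ‖P h 0‖ ^ 2 + (1 - v ^ 2) * ‖Q h 0‖ ^ 2 := by
    intro h hh
    have hd : ∀ t ∈ Icc 0 (T - h),
        HasDerivAt (fun t => ‖P h t‖ ^ 2 + (1 - v ^ 2) * ‖Q h t‖ ^ 2) 0 t := by
      intro t ht
      have h0 : t ∈ Icc 0 T := ⟨ht.1, by linarith [ht.2, hh.1]⟩
      have h1 : t + h ∈ Icc 0 T := ⟨by linarith [ht.1, hh.1], by linarith [ht.2]⟩
      -- `P h t` is the increment of `u`, so it may be used as a test element; this is where the
      -- boundary conditions enter.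
      have hmem : (P h t, q (t + h) - q t) ∈ S.topologicalClosure := by
        have := S.topologicalClosure.sub_mem (hS _ h1) (hS _ h0)
        rwa [Prod.mk_sub_mk, hu _ h0 _ h1] at this
      have heq := hw' _ hmem _ h0 _ h1
      rw [hR] at heq
      have hdP := (hasDerivAt_integral_window hp h t).norm_sq
      have hdQ := (hasDerivAt_integral_window hq h t).norm_sq
      refine (hdP.add (hdQ.const_mul (1 - v ^ 2))).congr_deriv ?_
      have e1 : f (t + h) + v • q (t + h) - (f t + v • q t) =
          (f (t + h) - f t) + v • (q (t + h) - q t) := by module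
      rw [e1]
      change 2 * inner ℝ (P h t) _ + (1 - v ^ 2) * (2 * inner ℝ (Q h t) _) = 0
      simp only [inner_add_left, inner_add_right, inner_smul_left, inner_smul_right,
        conj_trivial] at heq ⊢
      rw [real_inner_comm] at heq
      -- With `Δ` the increment over the window, `heq` says `⟨P, Δf⟩ = -⟨v P + (1 - v²) Q, Δq⟩`,
      -- which cancels all the remaining terms.
      linear_combination 2 * heq
    have := (convex_Icc 0 (T - h)).is_const_of_fderivWithin_eq_zero (𝕜 := ℝ)
      (f := fun t => ‖P h t‖ ^ 2 + (1 - v ^ 2) * ‖Q h t‖ ^ 2)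
      (fun t ht => (hd t ht).differentiableAt.differentiableWithinAt) ?_
      (x := T - h) (y := 0) ⟨by linarith [hh.2], le_rfl⟩ ⟨le_rfl, by linarith [hh.2]⟩
    · exact this
    · intro t ht
      have hlt : 0 < T - h := by linarith [hh.2]
      rw [((hd t ht).hasFDerivAt.hasFDerivWithinAt).fderivWithin
        (uniqueDiffOn_Icc hlt t ht)]
      ext; simp
  have hlim : ∀ (a : ℝ → H) (b : ℝ → H) (a' b' : H),
      Tendsto (fun h : ℝ => h⁻¹ • a h) (𝓝[>] 0) (𝓝 a') →
      Tendsto (fun h : ℝ => h⁻¹ • b h) (𝓝[>] 0) (𝓝 b') →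
      Tendsto (fun h : ℝ => (h⁻¹) ^ 2 * (‖a h‖ ^ 2 + (1 - v ^ 2) * ‖b h‖ ^ 2)) (𝓝[>] 0)
        (𝓝 (‖a'‖ ^ 2 + (1 - v ^ 2) * ‖b'‖ ^ 2)) := by
    intro a b a' b' ha hb
    refine ((ha.norm.pow 2).add ((hb.norm.pow 2).const_mul (1 - v ^ 2))).congr fun h => ?_
    simp only [norm_smul, mul_pow, Real.norm_eq_abs, sq_abs]
    ring
  have l1 := hlim _ _ _ _ (tendsto_average_left hp T) (tendsto_average_left hq T)
  have l2 := hlim _ _ _ _ (tendsto_average_right hp 0) (tendsto_average_right hq 0)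
  refine tendsto_nhds_unique (l1.congr' ?_) l2
  filter_upwards [Ioo_mem_nhdsGT hT] with h hh
  rw [← hconst h hh]

end Abstract

/-! ### Weak derivatives in time of continuous scalar functions. -/

section DuBoisReymond

/-- A smooth function of integral zero supported in `(0, T)` is the derivative of a test
function. -/
theorem IsTestFunction.exists_primitive {T : ℝ} {η : ℝ → ℝ}
    (hη : IsTestFunction (Ioo 0 T) η) (h0 : ∫ x in (0 : ℝ)..T, η x = 0) :
    ∃ b, IsTestFunction (Ioo 0 T) b ∧ deriv b = η := by
  rcases (tsupport η).eq_empty_or_nonempty with he | hne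
  · refine ⟨0, ⟨contDiff_const, HasCompactSupport.zero, ?_⟩, ?_⟩
    · simp [tsupport]
    · rw [tsupport_eq_empty_iff.1 he]
      ext; simp
  have hc : IsCompact (tsupport η) := hη.hasCompactSupport
  obtain ⟨α, hα, hαl⟩ := hc.exists_isLeast hne
  obtain ⟨β, hβ, hβg⟩ := hc.exists_isGreatest hne
  have hα' := hη.tsupport_subset hα
  have hβ' := hη.tsupport_subset hβ
  have hz : ∀ x, x ∉ Icc α β → η x = 0 := fun x hx =>
    image_eq_zero_of_notMem_tsupport fun h => hx ⟨hαl h, hβg h⟩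
  have hcont := hη.contDiff.continuous
  have hder : ∀ x, HasDerivAt (fun x => ∫ s in (0 : ℝ)..x, η s) (η x) x := fun x =>
    intervalIntegral.integral_hasDerivAt_right (hcont.intervalIntegrable _ _)
      (hcont.stronglyMeasurableAtFilter _ _) hcont.continuousAt
  have hderiv : deriv (fun x => ∫ s in (0 : ℝ)..x, η s) = η := funext fun x => (hder x).deriv
  -- Left of `α` the integrand vanishes on the whole range; right of `β` the primitive equals the
  -- total integral, which is zero.
  have hsub : tsupport (fun x => ∫ s in (0 : ℝ)..x, η s) ⊆ Icc α β := by
    refine closure_minimal (fun x hx => ?_) isClosed_Icc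
    by_contra hn
    apply hx
    rcases lt_or_ge x α with h | h
    · refine (intervalIntegral.integral_congr (g := fun _ => 0) fun s hs => ?_).trans (by simp)
      refine hz s fun hs' => ?_
      have := hs.2
      rcases max_cases 0 x with h' | h' <;> linarith [hs'.1, hα'.1]
    · have hxβ : β < x := by
        by_contra h2
        exact hn ⟨h, not_lt.1 h2⟩
      have : ∫ s in x..T, η s = 0 := by
        refine (intervalIntegral.integral_congr (g := fun _ => 0) fun s hs => ?_).trans (by simp)
        refine hz s fun hs' => ?_
        have := hs.1
        rcases min_cases x T with h' | h' <;> linarith [hs'.2, hβ'.2]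
      have h3 := intervalIntegral.integral_add_adjacent_intervals
        (hcont.intervalIntegrable (μ := volume) 0 x) (hcont.intervalIntegrable x T)
      show ∫ s in (0 : ℝ)..x, η s = 0
      linarith
  refine ⟨fun x => ∫ s in (0 : ℝ)..x, η s, ⟨?_, ?_, ?_⟩, hderiv⟩
  · refine contDiff_infty_iff_deriv.2 ⟨fun x => (hder x).differentiableAt, ?_⟩
    rw [hderiv]
    exact hη.contDiff
  · exact HasCompactSupport.of_support_subset_isCompact isCompact_Icc
      (subset_closure.trans hsub)
  · exact hsub.trans fun x hx => ⟨hα'.1.trans_le hx.1, hx.2.trans_lt hβ'.2⟩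

theorem IsTestFunction.sub_smul {X : Type*} [NormedAddCommGroup X] [NormedSpace ℝ X] {U : Set X}
    {a b : X → ℝ} (ha : IsTestFunction U a) (hb : IsTestFunction U b) (c : ℝ) :
    IsTestFunction U (fun x => a x - c * b x) := by
  have hs : tsupport (fun x => a x - c * b x) ⊆ tsupport a ∪ tsupport b := by
    refine closure_minimal (fun x hx => ?_) ((isClosed_tsupport a).union (isClosed_tsupport b))
    by_contra h
    rw [mem_union, not_or] at h
    apply hx
    simp [image_eq_zero_of_notMem_tsupport h.1, image_eq_zero_of_notMem_tsupport h.2]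
  refine ⟨ha.contDiff.sub (contDiff_const.mul hb.contDiff), ?_,
    hs.trans (union_subset ha.tsupport_subset hb.tsupport_subset)⟩
  exact HasCompactSupport.of_support_subset_isCompact
    (IsCompact.union ha.hasCompactSupport hb.hasCompactSupport) (subset_closure.trans hs)

/-- The fundamental lemma of the calculus of variations, in the form of du Bois-Reymond. -/
theorem exists_eqOn_const_of_integral_mul_deriv_eq_zero {T : ℝ} (hT : 0 < T) {K : ℝ → ℝ}
    (hK : Continuous K)
    (h : ∀ b, IsTestFunction (Ioo 0 T) b → ∫ x in (0 : ℝ)..T, K x * deriv b x = 0) :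
    ∃ c, ∀ x ∈ Icc 0 T, K x = c := by
  obtain ⟨η₀, h1, h2⟩ : ∃ η₀ : ℝ → ℝ, IsTestFunction (Ioo 0 T) η₀ ∧
      ∫ x in (0 : ℝ)..T, η₀ x = 1 := by
    let B : ContDiffBump (T / 2) := ⟨T / 8, T / 4, by positivity, by linarith⟩
    have hs : tsupport (B.normed volume) ⊆ Ioo 0 T := by
      rw [B.tsupport_normed_eq, Real.closedBall_eq_Icc]
      intro x hx
      have h1 := hx.1
      have h2 := hx.2
      change T / 2 - T / 4 ≤ x at h1
      change x ≤ T / 2 + T / 4 at h2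
      exact ⟨by linarith, by linarith⟩
    refine ⟨B.normed volume, ⟨B.contDiff_normed, B.hasCompactSupport_normed, hs⟩, ?_⟩
    rw [intervalIntegral.integral_of_le hT.le, setIntegral_eq_integral_of_forall_compl_eq_zero,
      B.integral_normed]
    intro x hx
    exact image_eq_zero_of_notMem_tsupport fun h => hx (Ioo_subset_Ioc_self (hs h))
  set c := ∫ x in (0 : ℝ)..T, K x * η₀ x with hc
  refine ⟨c, ?_⟩
  have key : ∀ η : ℝ → ℝ, IsTestFunction (Ioo 0 T) η →
      ∫ x in (0 : ℝ)..T, (K x - c) * η x = 0 := by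
    intro η hη
    have hηc := hη.contDiff.continuous
    have h1c := h1.contDiff.continuous
    set m := ∫ x in (0 : ℝ)..T, η x with hm
    -- Subtracting `m η₀` removes the mean, so the difference is the derivative of a test function.
    have hz : ∫ x in (0 : ℝ)..T, (η x - m * η₀ x) = 0 := by
      rw [intervalIntegral.integral_sub (hηc.intervalIntegrable _ _)
        ((h1c.const_mul m).intervalIntegrable _ _), intervalIntegral.integral_const_mul, h2]
      simp [hm]
    obtain ⟨b, hb, hb'⟩ := (hη.sub_smul h1 m).exists_primitive hz
    have h3 := h b hb
    rw [hb'] at h3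
    have e : ∀ x, (K x - c) * η x = K x * (η x - m * η₀ x) + m * (K x * η₀ x) - c * η x := by
      intro x; ring
    simp only [e]
    rw [intervalIntegral.integral_sub, intervalIntegral.integral_add, h3,
      intervalIntegral.integral_const_mul, intervalIntegral.integral_const_mul, ← hc, ← hm]
    · ring
    all_goals
      apply Continuous.intervalIntegrable
      fun_prop
  have hae : ∀ᵐ x ∂volume, x ∈ Ioo 0 T → K x - c = 0 := by
    refine isOpen_Ioo.ae_eq_zero_of_integral_contDiff_smul_eq_zero
      ((hK.sub continuous_const).locallyIntegrable.locallyIntegrableOn _) fun g hg hgc hgs => ?_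
    have h3 := key g ⟨hg, hgc, hgs⟩
    rw [intervalIntegral.integral_of_le hT.le, setIntegral_eq_integral_of_forall_compl_eq_zero]
      at h3
    · simpa [smul_eq_mul, mul_comm] using h3
    · intro x hx
      rw [image_eq_zero_of_notMem_tsupport fun h => hx (Ioo_subset_Ioc_self (hgs h)), mul_zero]
  have heq : EqOn K (fun _ => c) (Ioo 0 T) := by
    refine Measure.eqOn_open_of_ae_eq (μ := volume) ?_ isOpen_Ioo hK.continuousOn
      continuousOn_const
    rw [EventuallyEq, ae_restrict_iff' measurableSet_Ioo]
    filter_upwards [hae] with x hx hx'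
    linarith [hx hx']
  -- Continuity carries the equality to the endpoints, which are needed for the energies at times
  -- `0` and `T`.
  have := heq.closure hK continuous_const
  rw [closure_Ioo hT.ne] at this
  exact this

/-- A continuous function on `[0, T]` with a continuous weak derivative is a primitive of it. -/
theorem sub_eq_integral_of_weak_deriv {T : ℝ} (hT : 0 < T) {F g : ℝ → ℝ} (hF : Continuous F)
    (hg : Continuous g)
    (h : ∀ b, IsTestFunction (Ioo 0 T) b →
      ∫ x in (0 : ℝ)..T, F x * deriv b x = -∫ x in (0 : ℝ)..T, g x * b x)
    {s t : ℝ} (hs : s ∈ Icc 0 T) (ht : t ∈ Icc 0 T) : F t - F s = ∫ x in s..t, g x := by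
  have hder : ∀ x, HasDerivAt (fun x => ∫ s in (0 : ℝ)..x, g s) (g x) x := fun x =>
    intervalIntegral.integral_hasDerivAt_right (hg.intervalIntegrable _ _)
      (hg.stronglyMeasurableAtFilter _ _) hg.continuousAt
  have hGc : Continuous (fun x => ∫ s in (0 : ℝ)..x, g s) :=
    continuous_iff_continuousAt.2 fun x => (hder x).continuousAt
  obtain ⟨c, hc⟩ := exists_eqOn_const_of_integral_mul_deriv_eq_zero hT (hF.sub hGc) (by
    intro b hb
    have hb' : Continuous (deriv b) := hb.contDiff.continuous_deriv (by simp)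
    have hbd : ∀ x, HasDerivAt b (deriv b x) x := fun x =>
      (hb.contDiff.differentiable (by simp) x).hasDerivAt
    have hz : ∀ x, x ∉ Ioo 0 T → b x = 0 := fun x hx =>
      image_eq_zero_of_notMem_tsupport fun h => hx (hb.tsupport_subset h)
    have hparts := intervalIntegral.integral_mul_deriv_eq_deriv_mul (a := 0) (b := T)
      (fun x _ => hder x) (fun x _ => hbd x) (hg.intervalIntegrable _ _)
      (hb'.intervalIntegrable _ _)
    rw [hz T (by simp), hz 0 (by simp)] at hparts
    change ∫ x in (0 : ℝ)..T, (F x - ∫ s in (0 : ℝ)..x, g s) * deriv b x = 0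
    simp only [sub_mul]
    rw [intervalIntegral.integral_sub
      (Continuous.intervalIntegrable (by fun_prop) _ _)
      (Continuous.intervalIntegrable (by fun_prop) _ _), h b hb, hparts]
    ring)
  have h1 : F s - ∫ x in (0 : ℝ)..s, g x = c := hc s hs
  have h2 : F t - ∫ x in (0 : ℝ)..t, g x = c := hc t ht
  have h3 := intervalIntegral.integral_add_adjacent_intervals
    (hg.intervalIntegrable (μ := volume) 0 s) (hg.intervalIntegrable s t)
  linarith

end DuBoisReymond

/-! ### Test functions travelling with the string. -/

section TestFunctions

theorem IsTestFunction.eq_zero {X : Type*} [NormedAddCommGroup X] [NormedSpace ℝ X] {U : Set X}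
    {a : X → ℝ} (ha : IsTestFunction U a) {x : X} (hx : x ∉ U) : a x = 0 :=
  image_eq_zero_of_notMem_tsupport fun h => hx (ha.tsupport_subset h)

theorem IsTestFunction.isTestFunction_deriv {U : Set ℝ} {a : ℝ → ℝ} (ha : IsTestFunction U a) :
    IsTestFunction U (deriv a) :=
  ⟨(contDiff_infty_iff_deriv.1 ha.contDiff).2, ha.hasCompactSupport.deriv,
    tsupport_deriv_subset.trans ha.tsupport_subset⟩

theorem IsTestFunction.comp_sub_const {α β : ℝ} {a : ℝ → ℝ} (ha : IsTestFunction (Ioo α β) a)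
    (c : ℝ) : IsTestFunction (Ioo (α + c) (β + c)) (fun x => a (x - c)) := by
  refine ⟨ha.contDiff.comp (contDiff_id.sub contDiff_const),
    ha.hasCompactSupport.comp_homeomorph (Homeomorph.subRight c), ?_⟩
  refine (tsupport_comp_subset_preimage a (f := fun x => x - c) (by fun_prop)).trans ?_
  intro x hx
  have := ha.tsupport_subset hx
  exact ⟨by linarith [this.1], by linarith [this.2]⟩

theorem IsTestFunction.memLp {U : Set ℝ} {a : ℝ → ℝ} (ha : IsTestFunction U a) (s : Set ℝ) :
    MemLp a 2 (volume.restrict s) :=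
  (ha.contDiff.continuous.memLp_of_hasCompactSupport ha.hasCompactSupport).restrict s

/-- The product of a test function travelling with the string and a test function of the time. -/
theorem IsTestFunction.travelling {v L T : ℝ} {J : Set ℝ} {a b : ℝ → ℝ}
    (ha : IsTestFunction (Ioo 0 L) a) (hb : IsTestFunction (Ioo 0 T) b) (hJ : Icc 0 T ⊆ J) :
    IsTestFunction (domain v L J) (fun z => a (z.1 - v * z.2) * b z.2) := by
  set K : Set (ℝ × ℝ) := (fun z : ℝ × ℝ => (z.1 + v * z.2, z.2)) '' (tsupport a ×ˢ tsupport b)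
  have hK : IsCompact K := (IsCompact.prod ha.hasCompactSupport hb.hasCompactSupport).image
    (by fun_prop)
  have hs : tsupport (fun z : ℝ × ℝ => a (z.1 - v * z.2) * b z.2) ⊆ K := by
    refine closure_minimal (fun z hz => ?_) hK.isClosed
    have hz' := mul_ne_zero_iff.1 (Function.mem_support.1 hz)
    exact ⟨(z.1 - v * z.2, z.2), ⟨subset_tsupport _ hz'.1, subset_tsupport _ hz'.2⟩, by simp⟩
  refine ⟨?_, HasCompactSupport.of_support_subset_isCompact hK (subset_closure.trans hs),
    hs.trans ?_⟩
  · refine (ha.contDiff.comp ?_).mul (hb.contDiff.comp contDiff_snd)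
    fun_prop
  · rintro _ ⟨z, ⟨h1, h2⟩, rfl⟩
    have h1' := ha.tsupport_subset h1
    have h2' := hb.tsupport_subset h2
    refine ⟨interior_mono hJ (by rw [interior_Icc]; exact h2'), ?_, ?_⟩
    · simpa using h1'.1
    · simpa using h1'.2

/-- The transport term `-v a' b` is the source of the terms with `v` in both `f + v q` and `v f +
q`. -/
theorem IsTestFunction.deriv_travelling_time {U V : Set ℝ} {a b : ℝ → ℝ} (v : ℝ)
    (ha : IsTestFunction U a) (hb : IsTestFunction V b) (x t : ℝ) :
    deriv (fun s => a (x - v * s) * b s) t =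
      a (x - v * t) * deriv b t - v * (deriv a (x - v * t) * b t) := by
  have h1 : HasDerivAt a (deriv a (x - v * t)) (x - v * t) :=
    (ha.contDiff.differentiable (by simp) _).hasDerivAt
  have h2 : HasDerivAt b (deriv b t) t :=
    (hb.contDiff.differentiable (by simp) _).hasDerivAt
  have h3 : HasDerivAt (fun s => x - v * s) (-(v * 1)) t :=
    ((hasDerivAt_id t).const_mul v).const_sub x
  have h4 := (h1.comp t h3).mul h2
  have h5 := h4.deriv
  refine Eq.trans h5 ?_
  simp only [Function.comp_apply]
  ring

theorem deriv_travelling_space (a b : ℝ → ℝ) (v x t : ℝ) :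
    deriv (fun y => a (y - v * t) * b t) x = deriv a (x - v * t) * b t := by
  rw [deriv_mul_const_field, deriv_comp_sub_const]

end TestFunctions

/-! ### Translation of the moving interval to `L²(0, L)`. -/

section Slices

/-- The space `L²(0, L)` as a Hilbert space. -/
abbrev StringL2 (L : ℝ) : Type := Lp ℝ 2 (volume.restrict (Ioo 0 L))

theorem measurePreserving_shift (L c : ℝ) :
    MeasurePreserving (fun y => y + c) (volume.restrict (Ioo 0 L))
      (volume.restrict (Ioo c (L + c))) := by
  have h := (measurePreserving_add_right (volume : Measure ℝ) c).restrict_preimage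
    (measurableSet_Ioo (a := c) (b := L + c))
  simpa using h

theorem setIntegral_shift (L c : ℝ) (g : ℝ → ℝ) :
    ∫ y in Ioo 0 L, g (y + c) = ∫ x in Ioo c (L + c), g x :=
  (measurePreserving_shift L c).integral_comp (measurableEmbedding_addRight c) g

theorem MemL2.shift {L c : ℝ} {g : ℝ → ℝ} (hg : MemL2 c (L + c) g) :
    MemLp (fun y => g (y + c)) 2 (volume.restrict (Ioo 0 L)) :=
  MemLp.comp_measurePreserving hg (measurePreserving_shift L c)

open Classical in
/-- The class in `L²(0, L)` of the function `f (·, t)` on the moving interval, after translation. -/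
def slice (v L : ℝ) (f : ℝ → ℝ → ℝ) (t : ℝ) : StringL2 L :=
  -- The value `0` is a convention; the arguments below evaluate slices only at times where the
  -- function is in `L²`.
  if h : MemLp (fun y => f (y + v * t) t) 2 (volume.restrict (Ioo 0 L)) then h.toLp else 0

variable {v L : ℝ} {J : Set ℝ} {f : ℝ → ℝ → ℝ}

theorem coeFn_slice {t : ℝ} (h : MemL2 (v * t) (L + v * t) (fun x => f x t)) :
    slice v L f t =ᵐ[volume.restrict (Ioo 0 L)] fun y => f (y + v * t) t := by
  rw [slice, dif_pos h.shift]
  exact h.shift.coeFn_toLp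

theorem ContinuousL2.continuousOn_slice (hf : ContinuousL2 v L J f) :
    ContinuousOn (slice v L f) J := by
  intro s hs
  rw [ContinuousWithinAt, tendsto_iff_edist_tendsto_0]
  refine (hf.2 s hs).congr' ?_
  filter_upwards [self_mem_nhdsWithin] with t ht
  rw [slice, slice, dif_pos (hf.1 t ht).shift, dif_pos (hf.1 s hs).shift, Lp.edist_toLp_toLp]
  rfl

theorem inner_eq_setIntegral {g h : StringL2 L} {a b : ℝ → ℝ}
    (hg : g =ᵐ[volume.restrict (Ioo 0 L)] a) (hh : h =ᵐ[volume.restrict (Ioo 0 L)] b) :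
    inner ℝ g h = ∫ y in Ioo 0 L, a y * b y := by
  rw [L2.inner_def]
  refine integral_congr_ae ?_
  filter_upwards [hg, hh] with y h1 h2
  rw [h1, h2]
  simp [mul_comm]

theorem inner_slice {t : ℝ} (hf : MemL2 (v * t) (L + v * t) (fun x => f x t)) {g : StringL2 L}
    {a : ℝ → ℝ} (hg : g =ᵐ[volume.restrict (Ioo 0 L)] a) :
    inner ℝ (slice v L f t) g = ∫ x in interval v L t, f x t * a (x - v * t) := by
  rw [inner_eq_setIntegral (coeFn_slice hf) hg, interval, ← setIntegral_shift]
  simp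

theorem integrableOn_mul_travelling {t : ℝ} (hf : MemL2 (v * t) (L + v * t) (fun x => f x t))
    {a : ℝ → ℝ} (ha : IsTestFunction (Ioo 0 L) a) :
    IntegrableOn (fun x => f x t * a (x - v * t)) (interval v L t) :=
  MemLp.integrable_mul (p := 2) (q := 2) hf ((ha.comp_sub_const (v * t)).memLp _)

/-- The pairs `(a, a')` with `a` a test function on `(0, L)`. -/
def testPairs (L : ℝ) : Submodule ℝ (StringL2 L × StringL2 L) where
  carrier := {z | ∃ a, IsTestFunction (Ioo 0 L) a ∧ z.1 =ᵐ[volume.restrict (Ioo 0 L)] a ∧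
    z.2 =ᵐ[volume.restrict (Ioo 0 L)] deriv a}
  add_mem' := by
    rintro z w ⟨a, ha, h1, h2⟩ ⟨b, hb, h3, h4⟩
    have hda := ha.contDiff.differentiable (by simp)
    have hdb := hb.contDiff.differentiable (by simp)
    refine ⟨a + b, ⟨ha.contDiff.add hb.contDiff, ha.hasCompactSupport.add hb.hasCompactSupport,
      (tsupport_add a b).trans (union_subset ha.tsupport_subset hb.tsupport_subset)⟩, ?_, ?_⟩
    · exact (Lp.coeFn_add _ _).trans (h1.add h3)
    · refine (Lp.coeFn_add _ _).trans ((h2.add h4).trans (Eventually.of_forall fun x => ?_))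
      exact (deriv_add (hda x) (hdb x)).symm
  zero_mem' := by
    refine ⟨0, ⟨contDiff_const, HasCompactSupport.zero, by simp [tsupport]⟩, Lp.coeFn_zero _ _ _,
      (Lp.coeFn_zero _ _ _).trans (Eventually.of_forall fun x => ?_)⟩
    simp
  smul_mem' := by
    rintro c z ⟨a, ha, h1, h2⟩
    refine ⟨c • a, ⟨contDiff_const.smul ha.contDiff, ha.hasCompactSupport.smul_left, ?_⟩, ?_, ?_⟩
    · exact (closure_mono (Function.support_const_smul_subset c a)).trans ha.tsupport_subset
    · exact (Lp.coeFn_smul _ _).trans (h1.const_smul c)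
    · refine (Lp.coeFn_smul _ _).trans ((h2.const_smul c).trans (Eventually.of_forall fun x => ?_))
      exact (deriv_const_smul_field c a).symm

/-- The translates of the approximating test functions and of their derivatives converge in both
components, since translation preserves the `L²` norm. -/
theorem HasH10Deriv.slice_mem_closure {u p : ℝ → ℝ → ℝ} {t : ℝ}
    (h : HasH10Deriv (v * t) (L + v * t) (fun x => u x t) (fun x => p x t)) :
    (slice v L u t, slice v L p t) ∈ (testPairs L).topologicalClosure := by
  obtain ⟨ψ, hψ, h1, h2⟩ := h.approx
  have hψ' : ∀ n, IsTestFunction (Ioo 0 L) (fun y => ψ n (y + v * t)) := fun n => by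
    have := (hψ n).comp_sub_const (-(v * t))
    simpa using this
  have hderiv : ∀ n, deriv (fun y => ψ n (y + v * t)) = fun y => deriv (ψ n) (y + v * t) :=
    fun n => funext fun y => deriv_comp_add_const _ _ _
  have hlim : ∀ (w : ℝ → ℝ → ℝ) (χ : ℕ → ℝ → ℝ)
      (hw : MemL2 (v * t) (L + v * t) (fun x => w x t))
      (hχ : ∀ n, IsTestFunction (Ioo (v * t) (L + v * t)) (χ n))
      (hχ' : ∀ n, MemLp (fun y => χ n (y + v * t)) 2 (volume.restrict (Ioo 0 L))),
      Tendsto (fun n => normL2 (v * t) (L + v * t) (fun x => w x t - χ n x)) atTop (𝓝 0) →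
      Tendsto (fun n => (hχ' n).toLp) atTop (𝓝 (slice v L w t)) := by
    intro w χ hw hχ hχ' hl
    rw [tendsto_iff_edist_tendsto_0]
    refine hl.congr fun n => ?_
    rw [edist_comm, slice, dif_pos hw.shift, Lp.edist_toLp_toLp, normL2]
    exact (eLpNorm_comp_measurePreserving
      (hw.aestronglyMeasurable.sub ((hχ n).memLp _).aestronglyMeasurable)
      (measurePreserving_shift L (v * t))).symm
  have hm2 : ∀ n, MemLp (fun y => deriv (ψ n) (y + v * t)) 2 (volume.restrict (Ioo 0 L)) :=
    fun n => by
      have := (hψ' n).isTestFunction_deriv.memLp (Ioo 0 L)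
      rwa [hderiv n] at this
  have l1 := hlim u ψ h.memL2 hψ (fun n => (hψ' n).memLp _) h1
  have l2 := hlim p (fun n => deriv (ψ n)) h.memL2_deriv (fun n => (hψ n).isTestFunction_deriv) hm2 h2
  refine mem_closure_of_tendsto (l1.prodMk_nhds l2) (Eventually.of_forall fun n => ?_)
  refine ⟨_, hψ' n, ((hψ' n).memLp _).coeFn_toLp, ?_⟩
  rw [hderiv]
  exact (hm2 n).coeFn_toLp

/-- An element of `L²(0, L)` orthogonal to the test functions vanishes. -/
theorem eq_zero_of_inner_testPairs {w : StringL2 L}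
    (h : ∀ z ∈ testPairs L, inner ℝ w z.1 = 0) : w = 0 := by
  have hloc : LocallyIntegrableOn w (Ioo 0 L) volume := by
    have : IntegrableOn w (Ioo 0 L) volume := (Lp.memLp w).integrable (by norm_num)
    exact this.locallyIntegrableOn
  have hae := isOpen_Ioo.ae_eq_zero_of_integral_contDiff_smul_eq_zero hloc fun g hg hgc hgs => by
    have hgt : IsTestFunction (Ioo 0 L) g := ⟨hg, hgc, hgs⟩
    have h1 := h (((hgt.memLp (Ioo 0 L)).toLp g), ((hgt.isTestFunction_deriv.memLp (Ioo 0 L)).toLp _))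
      ⟨g, hgt, (hgt.memLp _).coeFn_toLp, (hgt.isTestFunction_deriv.memLp _).coeFn_toLp⟩
    rw [inner_eq_setIntegral (EventuallyEq.refl _ _) (hgt.memLp _).coeFn_toLp,
      setIntegral_eq_integral_of_forall_compl_eq_zero fun x hx => by simp [hgt.eq_zero hx]] at h1
    simpa [smul_eq_mul, mul_comm] using h1
  rw [Lp.eq_zero_iff_ae_eq_zero, EventuallyEq, ae_restrict_iff' measurableSet_Ioo]
  exact hae

theorem norm_sq_eq_setIntegral {g : StringL2 L} {a : ℝ → ℝ}
    (hg : g =ᵐ[volume.restrict (Ioo 0 L)] a) : ‖g‖ ^ 2 = ∫ y in Ioo 0 L, a y ^ 2 := by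
  rw [← real_inner_self_eq_norm_sq, inner_eq_setIntegral hg hg]
  simp only [sq]

end Slices

/-! ### Conservation and comparison of the energies. -/

section Energy

variable {v L T : ℝ} {J : Set ℝ} {φ0 φ1 : ℝ → ℝ} {φ φx φt : ℝ → ℝ → ℝ}

theorem setIntegral_eq_intervalIntegral_of_support (hT : 0 ≤ T) (hJm : MeasurableSet J)
    (hJ : Icc 0 T ⊆ J) {g : ℝ → ℝ} (hg : ∀ t, t ∉ Ioo 0 T → g t = 0) :
    ∫ t in J, g t = ∫ t in (0 : ℝ)..T, g t := by
  rw [intervalIntegral.integral_of_le hT]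
  exact setIntegral_eq_of_subset_of_forall_sdiff_eq_zero hJm (Ioc_subset_Icc_self.trans hJ)
    fun t ht => hg t fun h => ht.2 (Ioo_subset_Ioc_self h)

/-- Testing with `a (x - v t) b t`, the transport term is integrated by parts in space at each time,
which turns `φt` into the derivative `φt + v φx` along the motion. -/
theorem IsSolution.integral_time_deriv (hφ : IsSolution v L J φ0 φ1 φ φx φt) (hT : 0 ≤ T)
    (hJm : MeasurableSet J) (hJ : Icc 0 T ⊆ J) {z : StringL2 L × StringL2 L}
    (hz : z ∈ testPairs L) {b : ℝ → ℝ} (hb : IsTestFunction (Ioo 0 T) b) :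
    ∫ t in (0 : ℝ)..T, inner ℝ (slice v L φ t) z.1 * deriv b t =
      -∫ t in (0 : ℝ)..T, inner ℝ (slice v L φt t + v • slice v L φx t) z.1 * b t := by
  obtain ⟨a, ha, hz1, hz2⟩ := id hz
  have hw := hφ.weak_time_deriv _ (ha.travelling hb hJ)
  have hb' := hb.isTestFunction_deriv
  have hbc := hb.contDiff.continuous
  have hbc' := hb'.contDiff.continuous
  rw [setIntegral_eq_intervalIntegral_of_support hT hJm hJ,
    setIntegral_eq_intervalIntegral_of_support hT hJm hJ] at hw
  · have e1 : ∫ t in (0 : ℝ)..T, ∫ x in interval v L t,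
        φ x t * deriv (fun s => a (x - v * s) * b s) t =
        ∫ t in (0 : ℝ)..T, (inner ℝ (slice v L φ t) z.1 * deriv b t +
          v * inner ℝ (slice v L φx t) z.1 * b t) := by
      refine intervalIntegral.integral_congr fun t ht => ?_
      rw [uIcc_of_le hT] at ht
      have htJ := hJ ht
      have hm := hφ.continuous.1 t htJ
      have hmx := hφ.continuous_x.1 t htJ
      have i1 := (integrableOn_mul_travelling hm ha).mul_const (deriv b t)
      have i2 := (integrableOn_mul_travelling hm ha.isTestFunction_deriv).mul_const (v * b t)
      have hparts := (hφ.memH10 t htJ).weak_deriv (fun x => a (x - v * t)) (by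
        have := ha.comp_sub_const (v * t)
        rwa [zero_add] at this)
      simp only [deriv_comp_sub_const] at hparts
      simp only [ha.deriv_travelling_time v hb]
      have e : ∀ x, φ x t * (a (x - v * t) * deriv b t - v * (deriv a (x - v * t) * b t)) =
          φ x t * a (x - v * t) * deriv b t - φ x t * deriv a (x - v * t) * (v * b t) := by
        intro x; ring
      simp only [e]
      rw [integral_sub i1 i2, integral_mul_const, integral_mul_const, inner_slice hm hz1,
        inner_slice hmx hz1]
      simp only [interval]
      rw [hparts]
      ring
    have e2 : ∫ t in (0 : ℝ)..T, ∫ x in interval v L t, φt x t * (a (x - v * t) * b t) =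
        ∫ t in (0 : ℝ)..T, inner ℝ (slice v L φt t) z.1 * b t := by
      refine intervalIntegral.integral_congr fun t ht => ?_
      rw [uIcc_of_le hT] at ht
      simp only [← mul_assoc]
      rw [integral_mul_const, inner_slice (hφ.continuous_t.1 t (hJ ht)) hz1]
    have c1 := (hφ.continuous.continuousOn_slice.mono hJ).inner (𝕜 := ℝ)
      (continuousOn_const (c := z.1))
    have c2 := (hφ.continuous_x.continuousOn_slice.mono hJ).inner (𝕜 := ℝ)
      (continuousOn_const (c := z.1))
    have c3 := (hφ.continuous_t.continuousOn_slice.mono hJ).inner (𝕜 := ℝ)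
      (continuousOn_const (c := z.1))
    have hw' := (e1.symm.trans hw).trans (congrArg Neg.neg e2)
    have j1 : IntervalIntegrable (fun t => inner ℝ (slice v L φ t) z.1 * deriv b t) volume 0 T :=
      ContinuousOn.intervalIntegrable_of_Icc hT (c1.mul hbc'.continuousOn)
    have j2 : IntervalIntegrable (fun t => v * inner ℝ (slice v L φx t) z.1 * b t) volume 0 T :=
      ContinuousOn.intervalIntegrable_of_Icc hT ((c2.const_smul v).mul hbc.continuousOn)
    have j3 : IntervalIntegrable (fun t => inner ℝ (slice v L φt t) z.1 * b t) volume 0 T :=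
      ContinuousOn.intervalIntegrable_of_Icc hT (c3.mul hbc.continuousOn)
    rw [intervalIntegral.integral_add j1 j2] at hw'
    simp only [inner_add_left, inner_smul_left, conj_trivial, add_mul]
    rw [intervalIntegral.integral_add j3 j2]
    linarith
  · intro t ht
    simp [hb.eq_zero ht]
  · intro t ht
    simp only [ha.deriv_travelling_time v hb, hb.eq_zero ht, hb'.eq_zero ht]
    simp


/-- Here the transport term keeps its derivative on `a` and joins the one with `φx`, giving the flux
`v φt + φx`; no integration by parts is needed. -/
theorem IsSolution.integral_wave (hφ : IsSolution v L J φ0 φ1 φ φx φt) (hT : 0 ≤ T)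
    (hJm : MeasurableSet J) (hJ : Icc 0 T ⊆ J) {z : StringL2 L × StringL2 L}
    (hz : z ∈ testPairs L) {b : ℝ → ℝ} (hb : IsTestFunction (Ioo 0 T) b) :
    ∫ t in (0 : ℝ)..T, (inner ℝ (slice v L φt t) z.1 * deriv b t -
      inner ℝ (v • slice v L φt t + slice v L φx t) z.2 * b t) = 0 := by
  obtain ⟨a, ha, hz1, hz2⟩ := hz
  have hw := hφ.wave _ (ha.travelling hb hJ)
  have hb' := hb.isTestFunction_deriv
  rw [setIntegral_eq_intervalIntegral_of_support hT hJm hJ] at hw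
  · refine Eq.trans ?_ hw
    refine intervalIntegral.integral_congr fun t ht => ?_
    rw [uIcc_of_le hT] at ht
    have htJ := hJ ht
    have hmt := hφ.continuous_t.1 t htJ
    have hmx := hφ.continuous_x.1 t htJ
    have i1 := (integrableOn_mul_travelling hmt ha).mul_const (deriv b t)
    have i2 := (integrableOn_mul_travelling hmt ha.isTestFunction_deriv).mul_const (v * b t)
    have i3 := (integrableOn_mul_travelling hmx ha.isTestFunction_deriv).mul_const (b t)
    simp only [ha.deriv_travelling_time v hb, deriv_travelling_space]
    have e : ∀ x, φt x t * (a (x - v * t) * deriv b t - v * (deriv a (x - v * t) * b t)) -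
        φx x t * (deriv a (x - v * t) * b t) = φt x t * a (x - v * t) * deriv b t -
        φt x t * deriv a (x - v * t) * (v * b t) - φx x t * deriv a (x - v * t) * b t := by
      intro x; ring
    simp only [e]
    rw [integral_sub (by exact i1.sub i2) i3, integral_sub i1 i2, integral_mul_const, integral_mul_const,
      integral_mul_const, inner_add_left, inner_smul_left, inner_slice hmt hz1,
      inner_slice hmt hz2, inner_slice hmx hz2, conj_trivial]
    ring
  · intro t ht
    simp only [ha.deriv_travelling_time v hb, hb.eq_zero ht,
      hb'.eq_zero ht]
    simp

theorem energy_eq_norm_sq {t : ℝ} (hx : MemL2 (v * t) (L + v * t) (fun x => φx x t))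
    (ht : MemL2 (v * t) (L + v * t) (fun x => φt x t)) :
    energy v L φx φt t = 1 / 2 * (‖slice v L φt t + v • slice v L φx t‖ ^ 2 +
      (1 - v ^ 2) * ‖slice v L φx t‖ ^ 2) := by
  have h1 : ⇑(slice v L φt t + v • slice v L φx t) =ᵐ[volume.restrict (Ioo 0 L)]
      fun y => φt (y + v * t) t + v * φx (y + v * t) t := by
    refine (Lp.coeFn_add _ _).trans ((coeFn_slice ht).add ?_)
    exact (Lp.coeFn_smul _ _).trans ((coeFn_slice hx).const_smul v)
  rw [norm_sq_eq_setIntegral h1, norm_sq_eq_setIntegral (coeFn_slice hx), energy, interval,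
    setIntegral_shift L (v * t) (fun x => (φt x t + v * φx x t) ^ 2),
    setIntegral_shift L (v * t) (fun x => φx x t ^ 2), integral_add, integral_const_mul]
  · exact (MemLp.add ht (MemLp.const_mul hx v)).integrable_sq
  · exact (MemLp.integrable_sq hx).const_mul _

/-- The energy `𝓔_v` of a weak solution is conserved. -/
theorem IsSolution.energy_eq (hφ : IsSolution v L J φ0 φ1 φ φx φt) (hT : 0 < T)
    (hJm : MeasurableSet J) (hJ : Icc 0 T ⊆ J) :
    energy v L φx φt T = energy v L φx φt 0 := by
  -- Clamping time to `[0, T]` extends the slices to continuous curves on the whole line, as the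
  -- abstract result requires, without changing them on `[0, T]`.
  set c : ℝ → ℝ := fun t => max 0 (min t T) with hc
  have hcc : Continuous c := by fun_prop
  have hcI : ∀ t, c t ∈ Icc 0 T := fun t => ⟨le_max_left _ _, max_le hT.le (min_le_right _ _)⟩
  have hcid : ∀ t ∈ Icc 0 T, c t = t := fun t ht => by
    simp only [hc, min_eq_left ht.2, max_eq_right ht.1]
  have hcont : ∀ {f : ℝ → ℝ → ℝ}, ContinuousL2 v L J f →
      Continuous fun t => slice v L f (c t) := fun hf =>
    (hf.continuousOn_slice.mono hJ).comp_continuous hcc hcI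
  have hu := hcont hφ.continuous
  have hq := hcont hφ.continuous_x
  have hf := hcont hφ.continuous_t
  have h0 : (0 : ℝ) ∈ Icc 0 T := ⟨le_rfl, hT.le⟩
  have h1 : T ∈ Icc 0 T := ⟨hT.le, le_rfl⟩
  have key := energy_conserved (v := v) hT hq hf (testPairs L) (u := fun t => slice v L φ (c t))
    (fun t ht => (hφ.memH10 _ (hJ (hcI t))).slice_mem_closure) ?_ ?_
  · simp only [hcid 0 h0, hcid T h1] at key
    rw [energy_eq_norm_sq (hφ.continuous_x.1 T (hJ h1)) (hφ.continuous_t.1 T (hJ h1)),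
      energy_eq_norm_sq (hφ.continuous_x.1 0 (hJ h0)) (hφ.continuous_t.1 0 (hJ h0)), key]
  · intro s hs t ht
    have hp : Continuous fun t => slice v L φt (c t) + v • slice v L φx (c t) :=
      hf.add (hq.const_smul v)
    rw [← sub_eq_zero]
    -- The identity in `L²(0, L)` is checked against each test function, where it becomes a scalar
    -- statement in time.
    refine eq_zero_of_inner_testPairs fun z hz => ?_
    have hweak := sub_eq_integral_of_weak_deriv hT
      (F := fun t => inner ℝ (slice v L φ (c t)) z.1)
      (g := fun t => inner ℝ (slice v L φt (c t) + v • slice v L φx (c t)) z.1)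
      (hu.inner continuous_const) (hp.inner continuous_const) (fun b hb => ?_) hs ht
    · have hcomm := (innerSL ℝ z.1).intervalIntegral_comp_comm
        (hp.intervalIntegrable (μ := volume) s t)
      simp only [innerSL_apply_apply, real_inner_comm _ z.1] at hcomm
      rw [inner_sub_left, inner_sub_left, ← hcomm, sub_eq_zero]
      exact hweak
    · have h := hφ.integral_time_deriv hT.le hJm hJ hz hb
      refine Eq.trans ?_ (h.trans (congrArg Neg.neg ?_)) <;>
      · refine intervalIntegral.integral_congr fun t ht => ?_
        rw [uIcc_of_le hT.le] at ht
        simp only [hcid t ht]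
  · intro z hz s hs t ht
    have hr : Continuous fun t => v • slice v L φt (c t) + slice v L φx (c t) :=
      (hf.const_smul v).add hq
    have hFc : Continuous fun t => inner ℝ (slice v L φt (c t)) z.1 :=
      hf.inner continuous_const
    have hgc : Continuous fun t => inner ℝ (v • slice v L φt (c t) + slice v L φx (c t)) z.2 :=
      hr.inner continuous_const
    have hweak := sub_eq_integral_of_weak_deriv hT hFc hgc.neg (fun b hb => ?_) hs ht
    · rw [inner_sub_left, ← intervalIntegral.integral_neg]
      exact hweak
    · have h := hφ.integral_wave hT.le hJm hJ hz hb
      have hbc := hb.contDiff.continuous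
      have hbc' := hb.isTestFunction_deriv.contDiff.continuous
      have h2 : ∫ t in (0 : ℝ)..T, (inner ℝ (slice v L φt (c t)) z.1 * deriv b t -
          inner ℝ (v • slice v L φt (c t) + slice v L φx (c t)) z.2 * b t) = 0 := by
        refine Eq.trans (intervalIntegral.integral_congr fun t ht => ?_) h
        rw [uIcc_of_le hT.le] at ht
        simp only [hcid t ht]
      rw [intervalIntegral.integral_sub (by exact (hFc.mul hbc').intervalIntegrable _ _)
        (by exact (hgc.mul hbc).intervalIntegrable _ _)] at h2
      simp only [Pi.neg_apply, neg_mul, intervalIntegral.integral_neg, neg_neg]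
      linarith

/-- The density of `energy` is `φt² + 2 v φt φx + φx²`. It lies below `(1 + v) (φt² + φx²)` by `v
(φt - φx)²` and above `(1 - v) (φt² + φx²)` by `v (φt + φx)²`. -/
theorem energy_div_le_usualEnergy_and_le {t : ℝ} (hv0 : 0 < v) (hv1 : v < 1)
    (hx : MemL2 (v * t) (L + v * t) (fun x => φx x t))
    (ht : MemL2 (v * t) (L + v * t) (fun x => φt x t)) :
    energy v L φx φt t / (1 + v) ≤ usualEnergy v L φx φt t ∧
      usualEnergy v L φx φt t ≤ energy v L φx φt t / (1 - v) := by
  have i1 : IntegrableOn (fun x => (φt x t + v * φx x t) ^ 2 + (1 - v ^ 2) * φx x t ^ 2)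
      (interval v L t) :=
    (MemLp.add ht (MemLp.const_mul hx v)).integrable_sq.add
      ((MemLp.integrable_sq hx).const_mul _)
  have i2 : IntegrableOn (fun x => φt x t ^ 2 + φx x t ^ 2) (interval v L t) :=
    (MemLp.integrable_sq ht).add (MemLp.integrable_sq hx)
  rw [div_le_iff₀ (by linarith), le_div_iff₀ (by linarith), energy, usualEnergy]
  constructor
  · have := integral_mono i1 (i2.const_mul (1 + v)) fun x => by
      change _ ≤ (1 + v) * (φt x t ^ 2 + φx x t ^ 2)
      nlinarith [mul_nonneg hv0.le (sq_nonneg (φt x t - φx x t))]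
    rw [integral_const_mul] at this
    linarith
  · have := integral_mono (i2.const_mul (1 - v)) i1 fun x => by
      change (1 - v) * (φt x t ^ 2 + φx x t ^ 2) ≤ _
      nlinarith [mul_nonneg hv0.le (sq_nonneg (φt x t + φx x t))]
    rw [integral_const_mul] at this
    linarith

end Energy

end

end MovingString

theorem corollary3p1 (v L : ℝ) (hv0 : 0 < v) (hv1 : v < 1) (hL : 0 < L)
    (J : Set ℝ) (hJ : J = Set.Ici 0 ∨ ∃ T : ℝ, 0 < T ∧ J = Set.Icc 0 T)
    (φ0 φ1 : ℝ → ℝ) (hφ0 : MovingString.MemH10 0 L φ0) (hφ1 : MovingString.MemL2 0 L φ1)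
    (φ φx φt : ℝ → ℝ → ℝ) (hφ : MovingString.IsSolution v L J φ0 φ1 φ φx φt) :
    (∀ t ∈ J,
      MovingString.energy v L φx φt t / (1 + v) ≤ MovingString.usualEnergy v L φx φt t ∧
      MovingString.usualEnergy v L φx φt t ≤ MovingString.energy v L φx φt t / (1 - v)) ∧
    (∀ t ∈ J,
      1 / MovingString.gam v * MovingString.usualEnergy v L φx φt 0 ≤
        MovingString.usualEnergy v L φx φt t ∧
      MovingString.usualEnergy v L φx φt t ≤
        MovingString.gam v * MovingString.usualEnergy v L φx φt 0) := by
  have hequiv := fun t (ht : t ∈ J) => MovingString.energy_div_le_usualEnergy_and_le hv0 hv1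
    (hφ.continuous_x.1 t ht) (hφ.continuous_t.1 t ht)
  have hJm : MeasurableSet J := by
    rcases hJ with rfl | ⟨T, -, rfl⟩
    exacts [measurableSet_Ici, measurableSet_Icc]
  have hJ0 : ∀ t ∈ J, 0 ≤ t ∧ Icc 0 t ⊆ J := by
    rcases hJ with rfl | ⟨T, -, rfl⟩
    · exact fun t ht => ⟨ht, fun s hs => hs.1⟩
    · exact fun t ht => ⟨ht.1, fun s hs => ⟨hs.1, hs.2.trans ht.2⟩⟩
  refine ⟨hequiv, fun t ht => ?_⟩
  obtain ⟨ht0, htJ⟩ := hJ0 t ht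
  have hE : MovingString.energy v L φx φt t = MovingString.energy v L φx φt 0 := by
    rcases ht0.eq_or_lt with rfl | hpos
    · rfl
    · exact hφ.energy_eq hpos hJm htJ
  obtain ⟨h1, h2⟩ := hequiv t ht
  obtain ⟨h3, h4⟩ := hequiv 0 (htJ ⟨le_rfl, ht0⟩)
  have hm : 0 < 1 - v := by linarith
  have hp : 0 < 1 + v := by linarith
  -- The comparison is used at time `t` and at time `0` with the same conserved energy; the two
  -- constants combine to `(1 + v) / (1 - v)`.
  rw [hE] at h1 h2
  rw [div_le_iff₀ hp] at h1 h3
  rw [le_div_iff₀ hm] at h2 h4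
  rw [MovingString.gam, one_div_div, div_mul_eq_mul_div, div_mul_eq_mul_div, div_le_iff₀ hp,
    le_div_iff₀ hm]
  constructor <;> linarith
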